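/- A group has the finitely generated intersection property (FGIP) if the intersection of any two of its finitely generated subgroups is finitely generated. For a monomorphism $\phi\colon F\to F$ of a free group, the ascending HNN extension of $\phi$ is $\langle F,t \mid tft^{-1}=\phi(f)\ \forall f\in F\rangle$; it equals $F\rtimes_\phi\mathbb{Z}$ if $\phi$ is an automorphism. Let $V$ be a connected graph with a filtration by subgraphs $\emptyset=V^0\subsetneq V^1\subsetneq\cdots\subsetneq V^k=V$. A polynomial growth improved relative train track map $\Psi\colon V\to V$ (with respect to this filtration) is a map sending vertices to vertices and edges to combinatorial paths such that 1. $\Psi(V^r)\subseteq V^r$ for every $r$; 2. for every $r\ge 1$ the closure of $V^r-V^{r-1}$ is a single closed edge $e_r$ which, suitably oriented, satisfies $\Psi(e_r)=e_rP_r$, where $P_r$ is a (possibly trivial) closed path, all of whose edges lie in $V^{r-1}$ and whose initial point is fixed by $\Psi$. **Theorem.** Let $F$ be a non-cyclic free group of finite rank, let $\Psi\colon V\to V$ be a polynomial growth improved relative train track map of a connected graph $V$, let $p$ be a vertex of $V$, and identify $F$ with $\pi_1(V,p)$. Let $\phi\colon F\to F$ be a monomorphism induced by $\Psi$, i.e.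 $\phi([c])=[\gamma\,\Psi(c)\,\gamma^{-1}]$ for some path $\gamma$ in $V$ from $p$ to $\Psi(p)$. Then the ascending HNN extension of $\phi$ fails to have the FGIP. In particular, if $\phi$ is an automorphism, then $F\rtimes_\phi\mathbb{Z}$ fails to have the FGIP. -/

import Mathlib

universe u v w

/-- The finitely generated intersection property (Howson property). -/
def HasFGIP (G : Type*) [Group G] : Prop :=
  ∀ H K : Subgroup G, H.FG → K.FG → (H ⊓ K).FG

/-- The ascending HNN extension `⟨F, t ∣ t f t⁻¹ = φ f for all f ∈ F⟩` of a monomorphism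
`φ : F → F`. -/
abbrev AscendingHNN {F : Type*} [Group F] (φ : F →* F) (hφ : Function.Injective φ) : Type _ :=
  HNNExtension F ⊤ φ.range (Subgroup.topEquiv.trans (MonoidHom.ofInjective hφ))

namespace TrainTrack

open CategoryTheory Quiver

/-! A graph is a quiver `V`: the arrows are the geometric edges, each with an arbitrarily chosen
orientation. -/

/-- The type of all geometric edges of the graph. -/
abbrev Edge (V : Type u) [Quiver.{v} V] := Quiver.Total V

/-- Edges of the graph with either orientation, from `a` to `b`. -/
abbrev Dart {V : Type u} [Quiver.{v} V] (a b : V) := (a ⟶ b) ⊕ (b ⟶ a)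

/-- The geometric edge underlying an oriented edge. -/
def Dart.edge {V : Type u} [Quiver.{v} V] {a b : V} : Dart a b → Edge V
  | Sum.inl e => ⟨a, b, e⟩
  | Sum.inr e => ⟨b, a, e⟩

/-- Combinatorial paths: sequences of consecutive edges, crossed in either direction. -/
abbrev EdgePath {V : Type u} [Quiver.{v} V] (a b : V) :=
  @Quiver.Path (Symmetrify V) _ a b

/-- The path of length one along an oriented edge. -/
def Dart.toEdgePath {V : Type u} [Quiver.{v} V] {a b : V} (d : Dart a b) : EdgePath a b :=
  @Quiver.Hom.toPath (Symmetrify V) _ a b d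

/-- The graph is connected (it is nonempty as soon as a base point is given). -/
def IsConnectedGraph (V : Type u) [Quiver.{v} V] : Prop :=
  ∀ a b : V, Nonempty (EdgePath a b)

/-- A subgraph: a set of vertices and a set of edges containing the endpoints of its edges. -/
structure Subgraph (V : Type u) [Quiver.{v} V] where
  verts : Set V
  edges : Set (Edge V)
  left_mem : ∀ e ∈ edges, e.left ∈ verts
  right_mem : ∀ e ∈ edges, e.right ∈ verts

/-- All edges crossed by the path belong to `H`. -/
def EdgePath.InSubgraph {V : Type u} [Quiver.{v} V] (H : Subgraph V) {a : V} :
    ∀ {b : V}, EdgePath a b → Prop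
  | _, .nil => True
  | _, .cons p d => EdgePath.InSubgraph H p ∧ Dart.edge d ∈ H.edges

/-- A self-map of the graph sending vertices to vertices and edges to combinatorial paths. -/
structure GraphMap (V : Type u) [Quiver.{v} V] where
  obj : V → V
  map : ∀ {a b : V}, (a ⟶ b) → EdgePath (obj a) (obj b)

/-- The image of an oriented edge. -/
def GraphMap.mapDart {V : Type u} [Quiver.{v} V] (Ψ : GraphMap V) {a b : V} :
    Dart a b → EdgePath (Ψ.obj a) (Ψ.obj b)
  | Sum.inl e => Ψ.map e
  | Sum.inr e => (Ψ.map e).reverse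

/-- `Ψ` maps the subgraph `H` into itself. -/
def GraphMap.Preserves {V : Type u} [Quiver.{v} V] (Ψ : GraphMap V) (H : Subgraph V) : Prop :=
  (∀ a ∈ H.verts, Ψ.obj a ∈ H.verts) ∧
    ∀ e ∈ H.edges, EdgePath.InSubgraph H (Ψ.map e.hom)

/-- `Ψ` is a polynomial growth improved relative train track map with respect to the filtration
`∅ = Fil 0 ⊊ Fil 1 ⊊ ⋯ ⊊ Fil k = V`. The condition `single_edge` says that the closure of
`Fil (r+1) - Fil r` is one closed edge `d` (suitably oriented, from `a` to `b`), and that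
`Ψ(d) = d P` for a closed path `P` in `Fil r` based at a point fixed by `Ψ`. The path `P` may be
trivial (this is the only possibility in the bottom stratum); then `Ψ(d) = d`. -/
structure IsPolynomialIRTT {V : Type u} [Quiver.{v} V] (Ψ : GraphMap V) (k : ℕ)
    (Fil : Fin (k + 1) → Subgraph V) : Prop where
  bot_verts : (Fil 0).verts = ∅
  bot_edges : (Fil 0).edges = ∅
  top_verts : (Fil (Fin.last k)).verts = Set.univ
  top_edges : (Fil (Fin.last k)).edges = Set.univ
  mono_verts : ∀ r : Fin k, (Fil r.castSucc).verts ⊆ (Fil r.succ).verts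
  mono_edges : ∀ r : Fin k, (Fil r.castSucc).edges ⊆ (Fil r.succ).edges
  invariant : ∀ r, Ψ.Preserves (Fil r)
  single_edge : ∀ r : Fin k, ∃ (a b : V) (d : Dart a b),
    (Fil r.succ).edges \ (Fil r.castSucc).edges = {Dart.edge d} ∧
    (Fil r.succ).verts \ (Fil r.castSucc).verts ⊆ {a, b} ∧
    ∃ (ha : Ψ.obj a = a) (hb : Ψ.obj b = b) (P : EdgePath b b),
      EdgePath.InSubgraph (Fil r.castSucc) P ∧
      Ψ.mapDart d =
        @Quiver.Path.cast (Symmetrify V) _ _ _ _ _ ha.symm hb.symm (d.toEdgePath.comp P)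

/-- The homotopy class, relative to endpoints, of a combinatorial path, as a morphism of the
fundamental groupoid of the graph. -/
def EdgePath.homotopyClass {V : Type u} [Quiver.{v} V] {a b : V} (p : EdgePath a b) :
    (FreeGroupoid.of V).obj a ⟶ (FreeGroupoid.of V).obj b :=
  (Quotient.functor (@FreeGroupoid.redStep V _)).map p

/-- The functor induced by `Ψ` on the fundamental groupoid of the graph. -/
def GraphMap.functor {V : Type u} [Quiver.{v} V] (Ψ : GraphMap V) :
    Quiver.FreeGroupoid V ⥤ Quiver.FreeGroupoid V :=
  FreeGroupoid.lift
    { obj := fun a => (FreeGroupoid.of V).obj (Ψ.obj a)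
      map := fun e => EdgePath.homotopyClass (Ψ.map e) }

/-- The fundamental group of the graph `V` at `p`: homotopy classes of closed combinatorial paths
at `p`, multiplied by concatenation. -/
abbrev FundGroup (V : Type u) [Quiver.{v} V] (p : V) :=
  (FreeGroupoid.of V).obj p ⟶ (FreeGroupoid.of V).obj p

/-- Under the identification `ι` of `F` with `π₁(V, p)`, the endomorphism `φ` is induced by `Ψ`:
there is a path `γ` from `p` to `Ψ(p)` such that `φ` is `[c] ↦ [γ Ψ(c) γ⁻¹]`. -/
def IsInducedBy {V : Type u} [Quiver.{v} V] {F : Type w} [Group F] (φ : F →* F)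
    (Ψ : GraphMap V) (p : V) (ι : F ≃* FundGroup V p) : Prop :=
  ∃ γ : EdgePath p (Ψ.obj p), ∀ x : F,
    ι (φ x) = γ.homotopyClass ≫ Ψ.functor.map (ι x) ≫ Groupoid.inv γ.homotopyClass

end TrainTrack

/-! The aim is to find non-commuting `a`, `b` in `F` and an `s` in the extension, projecting to a
generator of `ℤ`, with `s a s⁻¹ = a` and `s b s⁻¹ = b a^m`. Put `u = b s` and let `N` be generated
by all `b^n a b^{-n}`. Then `u` normalizes `N`, and `⟨a, u⟩ = N⟨u⟩` meets `F`, which projects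
trivially to `ℤ`, exactly in `N`. Since `a` and `b` freely generate a free group, `N` is not
finitely generated, although `⟨a, u⟩` and `F` are (`not_hasFGIP_of_conj`).

To find the pair, note that `Ψ` fixes all vertices and so acts on every vertex group of the
fundamental groupoid. Suppose no such pair exists there. Climbing the filtration,
`Adjoin.map_eq_self` shows that `Ψ` fixes every loop; by the case `m = 0` loops at a vertex then
commute, so `F` is cyclic. Moving the pair to `p` costs an inner automorphism, which is absorbed by
taking `s = c t` (`exists_conj_unipotentPair`). -/

/-! ### Commuting and non-commuting elements of free groups -/

/-- Free groups are residually finite: a nontrivial element acts nontrivially on some finite set. -/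
theorem FreeGroup.exists_finite_perm_ne_one {α : Type*} (g : FreeGroup α) (hg : g ≠ 1) :
    ∃ (S : Finset (FreeGroup α)) (ρ : FreeGroup α →* Equiv.Perm S), ρ g ≠ 1 := by
  classical
  obtain ⟨L, rfl⟩ : ∃ L, FreeGroup.mk L = g := ⟨g.toWord, FreeGroup.mk_toWord⟩
  -- The suffixes of the word are the points visited on reading it from the right, starting at `1`.
  -- Left multiplication by a generator is a partial injection of this finite set, and any extension
  -- to permutations still carries `1` to `g`.
  let S : Finset (FreeGroup α) := (L.tails.map FreeGroup.mk).toFinset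
  have hS : ∀ L', L' <:+ L → FreeGroup.mk L' ∈ S := fun L' h => by
    simp only [S, List.mem_toFinset, List.mem_map, List.mem_tails]
    exact ⟨L', h, rfl⟩
  let e : ∀ x : α, {s : S // FreeGroup.of x * s.1 ∈ S} ≃ {s : S // (FreeGroup.of x)⁻¹ * s.1 ∈ S} :=
    fun x =>
    { toFun := fun s => ⟨⟨FreeGroup.of x * s.1.1, s.2⟩, by simp⟩
      invFun := fun s => ⟨⟨(FreeGroup.of x)⁻¹ * s.1.1, s.2⟩, by simp⟩
      left_inv := fun s => by simp
      right_inv := fun s => by simp }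
  let σ : α → Equiv.Perm S := fun x => (e x).extendSubtype
  have hσ : ∀ x (s : S) (h : FreeGroup.of x * s.1 ∈ S), σ x s = ⟨FreeGroup.of x * s.1, h⟩ :=
    fun x s h => Equiv.extendSubtype_apply_of_mem (e x) s h
  refine ⟨S, FreeGroup.lift σ, fun h => hg ?_⟩
  have key : ∀ L' (h : L' <:+ L),
      FreeGroup.lift σ (FreeGroup.mk L') ⟨1, hS [] (List.nil_suffix)⟩ = ⟨_, hS L' h⟩ := by
    intro L'
    induction L' with
    | nil => intro h; rfl
    | cons a L' ih =>
      intro h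
      have h' : L' <:+ L := (List.suffix_cons a L').trans h
      obtain ⟨x, _ | _⟩ := a
      · have hm : FreeGroup.mk ((x, false) :: L') = (FreeGroup.of x)⁻¹ * FreeGroup.mk L' := rfl
        have h2 : FreeGroup.of x * FreeGroup.mk ((x, false) :: L') = FreeGroup.mk L' := by
          rw [hm, mul_inv_cancel_left]
        have h1 := hσ x ⟨_, hS _ h⟩ (by rw [h2]; exact hS _ h')
        have h3 : σ x ⟨_, hS _ h⟩ = ⟨_, hS _ h'⟩ := h1.trans (Subtype.ext h2)
        refine (congrArg (fun w => FreeGroup.lift σ w _) hm).trans ?_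
        rw [_root_.map_mul, Equiv.Perm.mul_apply, ih h', _root_.map_inv, FreeGroup.lift_apply_of,
          ← h3]
        exact (σ x).symm_apply_apply _
      · have hm : FreeGroup.mk ((x, true) :: L') = FreeGroup.of x * FreeGroup.mk L' := rfl
        refine (congrArg (fun w => FreeGroup.lift σ w _) hm).trans ?_
        rw [_root_.map_mul, Equiv.Perm.mul_apply, ih h', FreeGroup.lift_apply_of]
        exact hσ x ⟨_, hS _ h'⟩ (hS _ h)
  have := key L List.suffix_rfl
  rw [h] at this
  exact (congrArg Subtype.val this).symm

/-- Free groups of finite rank are Hopfian. -/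
theorem FreeGroup.injective_of_surjective {α : Type*} [Finite α]
    (f : FreeGroup α →* FreeGroup α) (hf : Function.Surjective f) : Function.Injective f := by
  rw [injective_iff_map_eq_one]
  intro g hg
  by_contra hne
  obtain ⟨S, ρ, hρ⟩ := FreeGroup.exists_finite_perm_ne_one g hne
  -- Precomposition with `f` is an injective self-map of a finite set of homomorphisms, hence onto;
  -- so `ρ` factors through `f` and kills its kernel.
  have : Finite (FreeGroup α →* Equiv.Perm S) := Finite.of_equiv _ FreeGroup.lift
  have hinj : Function.Injective (fun r : FreeGroup α →* Equiv.Perm S => r.comp f) :=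
    fun r s h => (MonoidHom.cancel_right hf).1 h
  obtain ⟨r, hr⟩ := Finite.injective_iff_surjective.1 hinj ρ
  apply hρ
  rw [← hr, MonoidHom.comp_apply, hg, _root_.map_one]

/-- A free group with at most one generator is cyclic. -/
theorem IsFreeGroup.isCyclic_of_subsingleton {G : Type*} [Group G] [IsFreeGroup G]
    [Subsingleton (IsFreeGroup.Generators G)] : IsCyclic G := by
  have hfree : IsCyclic (FreeGroup (IsFreeGroup.Generators G)) := by
    cases isEmpty_or_nonempty (IsFreeGroup.Generators G) with
    | inl h => infer_instance
    | inr h =>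
      obtain ⟨x⟩ := h
      refine ⟨⟨FreeGroup.of x, fun g => ?_⟩⟩
      have hg : g ∈ Subgroup.closure (Set.range FreeGroup.of) := by
        rw [FreeGroup.closure_range_of]; trivial
      refine (Subgroup.closure_le (Subgroup.zpowers (FreeGroup.of x))).2 ?_ hg
      rintro _ ⟨y, rfl⟩
      rw [Subsingleton.elim y x]
      exact Subgroup.mem_zpowers _
  exact isCyclic_of_surjective (IsFreeGroup.mulEquiv G) (IsFreeGroup.mulEquiv G).surjective

/-- A commutative free group is cyclic. -/
theorem IsFreeGroup.isCyclic_of_commute {G : Type*} [Group G] [IsFreeGroup G]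
    (h : ∀ x y : G, Commute x y) : IsCyclic G := by
  have hsub : Subsingleton (IsFreeGroup.Generators G) := by
    refine ⟨fun x y => ?_⟩
    by_contra hxy
    classical
    let f : IsFreeGroup.Generators G → Equiv.Perm (Fin 3) :=
      fun z => if z = x then Equiv.swap 0 1 else Equiv.swap 1 2
    have hc := congrArg (IsFreeGroup.lift f) (h (IsFreeGroup.of x) (IsFreeGroup.of y)).eq
    rw [map_mul, map_mul, IsFreeGroup.lift_of, IsFreeGroup.lift_of] at hc
    simp only [f, if_true, if_neg (Ne.symm hxy)] at hc
    revert hc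
    decide
  exact IsFreeGroup.isCyclic_of_subsingleton

/-- A commutative subgroup of a free group is cyclic. -/
theorem IsFreeGroup.exists_eq_zpowers {G : Type*} [Group G] [IsFreeGroup G] (A : Subgroup G)
    (h : ∀ x ∈ A, ∀ y ∈ A, Commute x y) : ∃ g, A = Subgroup.zpowers g := by
  have : IsCyclic A := IsFreeGroup.isCyclic_of_commute fun x y =>
    Subtype.ext (h x x.2 y y.2)
  exact (Subgroup.isCyclic_iff_exists_zpowers_eq_top A).1 this |>.imp fun _ h => h.symm

/-- Commuting elements of a free group have a common power, if one of them is nontrivial. -/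
theorem IsFreeGroup.exists_zpow_eq_zpow {G : Type*} [Group G] [IsFreeGroup G] {x c : G}
    (h : Commute x c) (hc : c ≠ 1) : ∃ i j : ℤ, j ≠ 0 ∧ x ^ j = c ^ i := by
  obtain ⟨z, hz⟩ := IsFreeGroup.exists_eq_zpowers (Subgroup.closure {x, c}) (by
    have : ∀ y ∈ ({x, c} : Set G), ∀ z ∈ ({x, c} : Set G), y * z = z * y := by
      rintro y (rfl | rfl) z (rfl | rfl)
      · rfl
      · exact h
      · exact h.symm
      · rfl
    intro y hy z hz
    have := Subgroup.isMulCommutative_closure this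
    exact congrArg Subtype.val (mul_comm' (⟨y, hy⟩ : Subgroup.closure {x, c}) ⟨z, hz⟩))
  have hx : x ∈ Subgroup.zpowers z := hz ▸ Subgroup.subset_closure (by simp)
  have hc' : c ∈ Subgroup.zpowers z := hz ▸ Subgroup.subset_closure (by simp)
  obtain ⟨i, rfl⟩ := hx
  obtain ⟨j, rfl⟩ := hc'
  refine ⟨i, j, fun hj => hc (by simp [hj]), ?_⟩
  simp only [← zpow_mul, mul_comm i j]

/-- Two elements of a free group which do not commute freely generate a subgroup. -/
theorem IsFreeGroup.injective_lift_of_not_commute {G : Type*} [Group G] [IsFreeGroup G] {a b : G}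
    (h : ¬ Commute a b) :
    Function.Injective (FreeGroup.lift (fun i : Bool => if i then a else b)) := by
  classical
  set f := FreeGroup.lift (fun i : Bool => if i then a else b) with hf
  -- The range is free by Nielsen–Schreier and not cyclic, so it has two distinct basis elements and
  -- surjects onto `FreeGroup Bool`. The composite endomorphism of `FreeGroup Bool` is onto, hence
  -- injective by the Hopf property.
  have hL : ∃ x y : IsFreeGroup.Generators f.range, x ≠ y := by
    by_contra! hsub
    have : Subsingleton (IsFreeGroup.Generators f.range) := ⟨hsub⟩
    obtain ⟨g, hg⟩ := (IsFreeGroup.isCyclic_of_subsingleton (G := f.range)).exists_generator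
    obtain ⟨i, hi⟩ := hg ⟨a, FreeGroup.of true, by simp [hf]⟩
    obtain ⟨j, hj⟩ := hg ⟨b, FreeGroup.of false, by simp [hf]⟩
    apply h
    have hij : g ^ i * g ^ j = g ^ j * g ^ i := by rw [← zpow_add, ← zpow_add, add_comm]
    simp only at hi hj
    rw [hi, hj] at hij
    exact congrArg Subtype.val hij
  obtain ⟨x, y, hxy⟩ := hL
  let q : f.range →* FreeGroup Bool :=
    IsFreeGroup.lift fun z => if z = x then FreeGroup.of true else
      if z = y then FreeGroup.of false else 1
  have hq : Function.Surjective q := by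
    rw [← MonoidHom.range_eq_top, eq_top_iff, ← FreeGroup.closure_range_of, Subgroup.closure_le]
    rintro _ ⟨_ | _, rfl⟩
    · exact ⟨IsFreeGroup.of y, by simp [q, hxy.symm]⟩
    · exact ⟨IsFreeGroup.of x, by simp [q]⟩
  have := FreeGroup.injective_of_surjective (q.comp f.rangeRestrict)
    (hq.comp f.rangeRestrict_surjective)
  intro g₁ g₂ hg
  exact this (congrArg q (Subtype.ext hg : f.rangeRestrict g₁ = f.rangeRestrict g₂))

/-! ### A lamplighter action and infinite generation -/

/-- The shift of the first coordinate, a permutation of `ℤ × Bool`. -/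
def shiftPerm : Equiv.Perm (ℤ × Bool) := (Equiv.addRight (1 : ℤ)).prodCongr (Equiv.refl Bool)

theorem shiftPerm_zpow_apply (n : ℤ) (x : ℤ × Bool) : (shiftPerm ^ n) x = (x.1 + n, x.2) := by
  induction n using Int.induction_on generalizing x with
  | zero => simp
  | succ n ih =>
    rw [zpow_add_one, Equiv.Perm.mul_apply, ih]
    ext <;> simp [shiftPerm]; ring
  | pred n ih =>
    rw [zpow_sub_one, Equiv.Perm.mul_apply, ih]
    ext <;> simp [shiftPerm, Equiv.Perm.inv_def]; ring

/-- The conjugates of the transposition of `(0, false)` and `(0, true)` by powers of the shift. -/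
theorem shiftPerm_conj_swap_apply (n k : ℤ) (c : Bool) :
    (shiftPerm ^ n * Equiv.swap (0, false) (0, true) * (shiftPerm ^ n)⁻¹ :
      Equiv.Perm (ℤ × Bool)) (k, c) =
      (k, if k = n then !c else c) := by
  rw [← zpow_neg, Equiv.Perm.mul_apply, Equiv.Perm.mul_apply, shiftPerm_zpow_apply (-n)]
  by_cases h : k = n
  · subst h
    cases c <;> simp [shiftPerm_zpow_apply]
  · have h' : k + -n ≠ 0 := fun h' => h (by omega)
    rw [Equiv.swap_apply_of_ne_of_ne (by simp [h']) (by simp [h']), shiftPerm_zpow_apply]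
    simp [h]

/-- If `a` and `b` are non-commuting elements of a free group, then the normal closure of `a` in the
subgroup generated by `a` and `b` is not finitely generated. -/
theorem IsFreeGroup.not_fg_closure_conj {F : Type*} [Group F] [IsFreeGroup F] {a b : F}
    (hab : ¬ Commute a b) :
    ¬ (Subgroup.closure (Set.range fun n : ℤ => b ^ n * a * (b ^ n)⁻¹)).FG := by
  have hinj := IsFreeGroup.injective_lift_of_not_commute hab
  set f := FreeGroup.lift (fun i : Bool => if i then a else b) with hf
  let ρ : FreeGroup Bool →* Equiv.Perm (ℤ × Bool) :=
    FreeGroup.lift fun i => if i then Equiv.swap (0, false) (0, true) else shiftPerm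
  let c : ℤ → FreeGroup Bool := fun n =>
    FreeGroup.of false ^ n * FreeGroup.of true * (FreeGroup.of false ^ n)⁻¹
  have hfc : ∀ n, f (c n) = b ^ n * a * (b ^ n)⁻¹ := fun n => by simp [c, hf]
  have hρc : ∀ n k d, ρ (c n) (k, d) = (k, if k = n then !d else d) := fun n k d => by
    rw [← shiftPerm_conj_swap_apply]
    simp [c, ρ]
  -- `R K` fixes all columns from `K` on. A finite generating set would lie in the image of a single
  -- `R K`, but `c K` moves column `K`.
  let R : ℤ → Subgroup (FreeGroup Bool) := fun K =>
    { carrier := {w | ∀ k, K ≤ k → ∀ d, ρ w (k, d) = (k, d)}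
      one_mem' := fun k _ d => by simp
      mul_mem' := fun {x y} hx hy k hk d => by
        rw [map_mul, Equiv.Perm.mul_apply, hy k hk, hx k hk]
      inv_mem' := fun {x} hx k hk d => by
        rw [map_inv, Equiv.Perm.inv_eq_iff_eq, hx k hk] }
  have hmono : ∀ {K K'}, K ≤ K' → R K ≤ R K' := fun h w hw k hk => hw k (h.trans hk)
  have hmem : ∀ x ∈ Subgroup.closure (Set.range fun n : ℤ => b ^ n * a * (b ^ n)⁻¹),
      ∃ K, x ∈ (R K).map f := by
    intro x hx
    induction hx using Subgroup.closure_induction with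
    | mem x hx =>
      obtain ⟨n, rfl⟩ := hx
      exact ⟨n + 1, c n, fun k hk d => by rw [hρc, if_neg (by omega)], hfc n⟩
    | one => exact ⟨0, one_mem _⟩
    | mul x y _ _ hx hy =>
      obtain ⟨K, hK⟩ := hx
      obtain ⟨K', hK'⟩ := hy
      exact ⟨max K K', mul_mem (Subgroup.map_mono (hmono (le_max_left _ _)) hK)
        (Subgroup.map_mono (hmono (le_max_right _ _)) hK')⟩
    | inv x _ hx =>
      obtain ⟨K, hK⟩ := hx
      exact ⟨K, inv_mem hK⟩
  rintro ⟨T, hT⟩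
  have hT' : ∀ x ∈ T, ∃ K, x ∈ (R K).map f := fun x hx =>
    hmem x (hT ▸ Subgroup.subset_closure hx)
  choose! κ hκ using hT'
  obtain ⟨K, hK⟩ := (T.image κ).exists_le
  have hle : Subgroup.closure (Set.range fun n : ℤ => b ^ n * a * (b ^ n)⁻¹) ≤ (R K).map f := by
    rw [← hT, Subgroup.closure_le]
    exact fun x hx => Subgroup.map_mono
      (hmono (hK _ (Finset.mem_image_of_mem κ hx))) (hκ x hx)
  obtain ⟨w, hw, hwc⟩ := hle (Subgroup.subset_closure ⟨K, rfl⟩)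
  have hwc' : w = c K := hinj (hwc.trans (hfc K).symm)
  have := hw K le_rfl true
  rw [hwc', hρc] at this
  simp at this

/-! ### The criterion for failure of the FGIP -/

/-- A group mapping to `ℤ` and containing a free group of finite rank in the kernel fails to have
the FGIP, if an element `s` mapping to a generator of `ℤ` acts on two non-commuting elements `a`, `b`
of the free group by `a ↦ a` and `b ↦ b * a ^ m`. -/
theorem not_hasFGIP_of_conj {F G : Type*} [Group F] [IsFreeGroup F] [Group.FG F] [Group G]
    (j : F →* G) (hj : Function.Injective j) (π : G →* Multiplicative ℤ) (hπ : ∀ x, π (j x) = 1)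
    (s : G) (hs : π s = Multiplicative.ofAdd 1) {a b : F} (hab : ¬ Commute a b) (m : ℤ)
    (ha : s * j a * s⁻¹ = j a) (hb : s * j b * s⁻¹ = j (b * a ^ m)) : ¬ HasFGIP G := by
  intro hG
  set N := Subgroup.closure (Set.range fun n : ℤ => b ^ n * a * (b ^ n)⁻¹) with hN
  have haN : a ∈ N := Subgroup.subset_closure ⟨0, by simp⟩
  -- `N` is normalized by `a` and by `b`.
  have hbN : ∀ (n : ℤ), ∀ x ∈ N, b ^ n * x * (b ^ n)⁻¹ ∈ N := by
    intro n x hx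
    induction hx using Subgroup.closure_induction with
    | mem x hx =>
      obtain ⟨k, rfl⟩ := hx
      refine Subgroup.subset_closure ⟨n + k, ?_⟩
      simp only [zpow_add]
      group
    | one => simp
    | mul x y _ _ hx hy =>
      convert mul_mem hx hy using 1
      group
    | inv x _ hx =>
      convert inv_mem hx using 1
      group
  -- `N` contains `a` and is normalized by `b`, so `b a^l` and `b` agree modulo `N`.
  have hbk : ∀ (l n : ℤ), ∃ y ∈ N, (b * a ^ l) ^ n = y * b ^ n := by
    intro l n
    have hy1 : b * a ^ l * b⁻¹ ∈ N := by
      simpa using hbN 1 _ (zpow_mem haN l)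
    have hy2 : (a ^ l)⁻¹ ∈ N := inv_mem (zpow_mem haN l)
    induction n using Int.induction_on with
    | zero => exact ⟨1, one_mem _, by simp⟩
    | succ n ih =>
      obtain ⟨y, hy, h⟩ := ih
      refine ⟨_, mul_mem hy (hbN n _ hy1), ?_⟩
      rw [zpow_add_one, h, zpow_add_one]
      group
    | pred n ih =>
      obtain ⟨y, hy, h⟩ := ih
      refine ⟨_, mul_mem hy (hbN (-n) _ hy2), ?_⟩
      rw [zpow_sub_one, h, zpow_sub_one]
      group
  have hconj : ∀ (l n : ℤ), (b * a ^ l) ^ n * a * ((b * a ^ l) ^ n)⁻¹ ∈ N := by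
    intro l n
    obtain ⟨y, hy, h⟩ := hbk l n
    convert mul_mem (mul_mem hy (hbN n a haN)) (inv_mem hy) using 1
    rw [h]
    group
  -- A general `g` covers both `s` with exponent `m` and `s⁻¹` with exponent `-m`.
  have hsN : ∀ (g : G) (l : ℤ), MulAut.conj g (j a) = j a →
      MulAut.conj g (j b) = j (b * a ^ l) → ∀ x ∈ N, ∃ y ∈ N, MulAut.conj g (j x) = j y := by
    intro g l hga hgb x hx
    induction hx using Subgroup.closure_induction with
    | mem x hx =>
      obtain ⟨n, rfl⟩ := hx
      refine ⟨_, hconj l n, ?_⟩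
      simp only [map_mul, map_inv, map_zpow, hga, hgb]
    | one => exact ⟨1, one_mem _, by simp⟩
    | mul x y _ _ hx hy =>
      obtain ⟨x', hx', h1⟩ := hx
      obtain ⟨y', hy', h2⟩ := hy
      exact ⟨_, mul_mem hx' hy', by simp only [map_mul, h1, h2]⟩
    | inv x _ hx =>
      obtain ⟨x', hx', h1⟩ := hx
      exact ⟨_, inv_mem hx', by simp only [map_inv, h1]⟩
  have hsa : MulAut.conj s⁻¹ (j a) = j a := by
    have : MulAut.conj s (j a) = j a := ha
    rw [map_inv, MulAut.inv_apply, MulEquiv.symm_apply_eq, this]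
  have hsb : MulAut.conj s⁻¹ (j b) = j (b * a ^ (-m)) := by
    have h1 : MulAut.conj s (j a) = j a := ha
    have h2 : MulAut.conj s (j b) = j (b * a ^ m) := hb
    rw [map_inv, MulAut.inv_apply, MulEquiv.symm_apply_eq, map_mul, map_mul, h2, map_zpow, map_zpow,
      h1, map_mul, map_zpow, mul_assoc, ← zpow_add, add_neg_cancel, zpow_zero, mul_one]
  have hsna : ∀ n : ℤ, MulAut.conj (s ^ n) (j a) = j a := by
    intro n
    rw [map_zpow]
    induction n using Int.induction_on with
    | zero => simp
    | succ n ih => rw [zpow_add_one, MulAut.mul_apply, MulAut.conj_apply, ha, ih]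
    | pred n ih => rw [zpow_sub_one, MulAut.mul_apply, ← map_inv, hsa, ih]
  have hsnb : ∀ n : ℤ, MulAut.conj (s ^ n) (j b) = j (b * a ^ (m * n)) := by
    intro n
    rw [map_zpow]
    induction n using Int.induction_on with
    | zero => simp
    | succ n ih =>
      have ha' := hsna n
      rw [map_zpow] at ha'
      rw [zpow_add_one, MulAut.mul_apply, MulAut.conj_apply, hb, map_mul, map_mul, ih, map_zpow,
        map_zpow, ha', map_mul, map_mul, map_zpow, map_zpow, mul_assoc, ← zpow_add]
      ring_nf
    | pred n ih =>
      have ha' := hsna (-n)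
      rw [map_zpow] at ha'
      rw [zpow_sub_one, MulAut.mul_apply, ← map_inv, hsb, map_mul, map_mul, ih, map_zpow,
        map_zpow, ha', map_mul, map_mul, map_zpow, map_zpow, mul_assoc, ← zpow_add]
      ring_nf
  set u := j b * s with hu
  have huN : ∀ (i : ℤ), ∀ x ∈ N, ∃ y ∈ N, u ^ i * j x = j y * u ^ i := by
    intro i
    induction i using Int.induction_on with
    | zero => exact fun x hx => ⟨x, hx, by simp⟩
    | succ n ih =>
      intro x hx
      obtain ⟨y, hy, h⟩ := hsN s m ha hb x hx
      obtain ⟨z, hz, h'⟩ := ih _ (hbN 1 y hy)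
      refine ⟨z, hz, ?_⟩
      rw [zpow_add_one, ← mul_assoc (j z), ← h', mul_assoc _ u, mul_assoc _ _ u]
      congr 1
      simp only [map_mul, map_inv, zpow_one, ← h, MulAut.conj_apply, hu]
      group
    | pred n ih =>
      intro x hx
      obtain ⟨y, hy, h⟩ := hsN s⁻¹ (-m) hsa hsb _ (hbN (-1) x hx)
      obtain ⟨z, hz, h'⟩ := ih y hy
      refine ⟨z, hz, ?_⟩
      rw [zpow_sub_one, ← mul_assoc (j z), ← h', mul_assoc, mul_assoc]
      congr 1
      rw [← h, MulAut.conj_apply]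
      simp only [map_mul, map_inv, map_zpow, hu]
      group
  have hH : ∀ h ∈ Subgroup.closure {j a, u}, ∃ x ∈ N, ∃ i : ℤ, h = j x * u ^ i := by
    intro h hh
    induction hh using Subgroup.closure_induction with
    | mem h hh =>
      obtain rfl | rfl := hh
      · exact ⟨a, haN, 0, by simp⟩
      · exact ⟨1, one_mem _, 1, by simp⟩
    | one => exact ⟨1, one_mem _, 0, by simp⟩
    | mul h h' _ _ hx hy =>
      obtain ⟨x, hx, i, rfl⟩ := hx
      obtain ⟨y, hy, k, rfl⟩ := hy
      obtain ⟨z, hz, h⟩ := huN i y hy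
      refine ⟨x * z, mul_mem hx hz, i + k, ?_⟩
      rw [mul_assoc, ← mul_assoc (u ^ i), h, map_mul, zpow_add]
      group
    | inv h _ hx =>
      obtain ⟨x, hx, i, rfl⟩ := hx
      obtain ⟨z, hz, h⟩ := huN (-i) _ (inv_mem hx)
      refine ⟨z, hz, -i, ?_⟩
      rw [← h, map_inv]
      group
  have hπu : π u = Multiplicative.ofAdd 1 := by rw [hu, map_mul, hπ, hs, one_mul]
  have hinter : Subgroup.closure {j a, u} ⊓ j.range = N.map j := by
    -- Since `s^{-n} b s^n = b a^{-mn}`, the element `b^n s^n` is a product of copies of `u` and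
    -- powers of `a`, and their inverses. As `s` centralizes `a`, it conjugates `a` to `b^n a
    -- b^{-n}`.
    have hbs : ∀ n : ℤ, j b ^ n * s ^ n ∈ Subgroup.closure {j a, u} := by
      have haH : j a ∈ Subgroup.closure {j a, u} := Subgroup.subset_closure (by simp)
      have huH : u ∈ Subgroup.closure {j a, u} := Subgroup.subset_closure (by simp)
      have hstep : ∀ n : ℤ, j b ^ (n + 1) * s ^ (n + 1) =
          j b ^ n * s ^ n * (u * j a ^ (m * -n)) := by
        intro n
        have h1 : s ^ (-n) * j b * (s ^ (-n))⁻¹ = j b * j a ^ (m * -n) := by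
          rw [← map_zpow, ← map_mul]; exact hsnb (-n)
        have h2 : j a ^ (m * -n) = s * j a ^ (m * -n) * s⁻¹ := by rw [← conj_zpow, ha]
        have h3 : j b * s * j a ^ (m * -n) = s ^ (-n) * j b * s ^ n * s := by
          rw [show s ^ n = (s ^ (-n))⁻¹ by group, h1, mul_assoc, mul_assoc]
          nth_rw 2 [h2]
          group
        rw [hu, h3]
        group
      intro n
      induction n using Int.induction_on with
      | zero => simp
      | succ n ih => rw [hstep]; exact mul_mem ih (mul_mem huH (zpow_mem haH _))
      | pred n ih =>
        have h := hstep (-n - 1)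
        rw [sub_add_cancel, ← mul_inv_eq_iff_eq_mul] at h
        rw [← h]
        exact mul_mem ih (inv_mem (mul_mem huH (zpow_mem haH _)))
    apply le_antisymm
    · rintro _ ⟨hh, y, rfl⟩
      obtain ⟨x, hx, i, hi⟩ := hH _ hh
      have h0 := congrArg π hi
      rw [hπ, map_mul, hπ, one_mul, map_zpow, hπu, ← ofAdd_zsmul] at h0
      have hi0 : i = 0 := by simpa using (congrArg Multiplicative.toAdd h0).symm
      rw [hi0, zpow_zero, mul_one] at hi
      exact ⟨x, hx, hi.symm⟩
    · refine le_inf ?_ (Subgroup.map_le_range j N)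
      rw [Subgroup.map_le_iff_le_comap, hN, Subgroup.closure_le]
      rintro _ ⟨n, rfl⟩
      have := mul_mem (mul_mem (hbs n) (Subgroup.subset_closure (Set.mem_insert _ _)))
        (inv_mem (hbs n))
      have han : s ^ n * j a * (s ^ n)⁻¹ = j a := hsna n
      have heq : j b ^ n * s ^ n * j a * (j b ^ n * s ^ n)⁻¹ = j (b ^ n * a * (b ^ n)⁻¹) := by
        rw [map_mul, map_mul, map_inv, map_zpow]
        nth_rw 2 [← han]
        group
      rw [heq] at this
      exact this
  have hfg := hG (Subgroup.closure {j a, u}) j.range 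
    ((Subgroup.fg_iff _).2 ⟨_, rfl, Set.toFinite _⟩)
    ((Group.fg_iff_subgroup_fg _).1 inferInstance)
  rw [hinter] at hfg
  apply IsFreeGroup.not_fg_closure_conj hab
  have hfg' : Group.FG (N.map j) := (Group.fg_iff_subgroup_fg _).2 hfg
  exact (Group.fg_iff_subgroup_fg _).1 (Group.fg_of_surjective
    (f := (N.equivMapOfInjective j hj).symm.toMonoidHom) (MulEquiv.surjective _))

namespace TrainTrack

open CategoryTheory Quiver

/-! ### Adjoining one morphism to a subgroupoid -/

section Groupoid

variable {C : Type u} [Groupoid.{v} C]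

/-- The morphisms of the subgroupoid generated by a wide subgroupoid `M` and a morphism `d`. -/
inductive Adjoin (M : Subgroupoid C) {a b : C} (d : a ⟶ b) {x : C} : ∀ {y : C}, (x ⟶ y) → Prop
  | refl : Adjoin M d (𝟙 x)
  | comp_mem {y z : C} (f : x ⟶ y) (g : y ⟶ z) (hf : Adjoin M d f) (hg : g ∈ M.arrows y z) :
      Adjoin M d (f ≫ g)
  | comp_hom (f : x ⟶ a) (hf : Adjoin M d f) : Adjoin M d (f ≫ d)
  | comp_inv (f : x ⟶ b) (hf : Adjoin M d f) : Adjoin M d (f ≫ inv d)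

variable {M : Subgroupoid C} {a b : C} {d : a ⟶ b}

theorem Adjoin.of_mem {x y : C} {g : x ⟶ y} (hg : g ∈ M.arrows x y) : Adjoin M d g := by
  simpa using Adjoin.comp_mem (𝟙 x) g .refl hg

theorem Adjoin.of_hom : Adjoin M d d := by
  simpa using Adjoin.comp_hom (M := M) (d := d) (𝟙 a) .refl

theorem Adjoin.of_inv : Adjoin M d (inv d) := by
  simpa using Adjoin.comp_inv (M := M) (d := d) (𝟙 b) .refl

theorem Adjoin.comp {x y z : C} {f : x ⟶ y} {g : y ⟶ z} (hf : Adjoin M d f) (hg : Adjoin M d g) :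
    Adjoin M d (f ≫ g) := by
  induction hg with
  | refl => simpa using hf
  | comp_mem g h _ hh ih => rw [← Category.assoc]; exact .comp_mem _ _ ih hh
  | comp_hom g _ ih => rw [← Category.assoc]; exact .comp_hom _ ih
  | comp_inv g _ ih => rw [← Category.assoc]; exact .comp_inv _ ih

theorem Adjoin.symm {x y : C} {f : x ⟶ y} (hf : Adjoin M d f) : Adjoin M d (inv f) := by
  induction hf with
  | refl => simpa using Adjoin.refl
  | comp_mem g h _ hh ih =>
    rw [IsIso.inv_comp]
    exact (Adjoin.of_mem (by simpa using M.inv hh)).comp ih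
  | comp_hom g _ ih => rw [IsIso.inv_comp]; exact Adjoin.of_inv.comp ih
  | comp_inv g _ ih => rw [IsIso.inv_comp, IsIso.inv_inv]; exact Adjoin.of_hom.comp ih

/-- A morphism of the subgroupoid generated by `M` and `d : a ⟶ b` lies in `M`, or its source is
connected to `a`. -/
theorem Adjoin.mem_or_exists (hM : ∀ c, 𝟙 c ∈ M.arrows c c) {x y : C} {f : x ⟶ y}
    (hf : Adjoin M d f) : f ∈ M.arrows x y ∨ ∃ g : a ⟶ x, Adjoin M d g := by
  induction hf with
  | refl => exact .inl (hM _)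
  | comp_mem g h _ hh ih => exact ih.imp (fun hg => M.mul hg hh) id
  | comp_hom g hg ih => exact .inr ⟨inv g, hg.symm⟩
  | comp_inv g hg ih => exact .inr ⟨d ≫ inv g, Adjoin.of_hom.comp hg.symm⟩

/-- Any subgroup which contains the loops of `M` at `a`, the conjugates by `d` of the loops of `M`
at `b` and the loops consisting of `d` and a morphism of `M`, contains all loops at `a` of the
subgroupoid generated by `M` and `d`. -/
theorem Adjoin.mem_subgroup (hM : ∀ c, 𝟙 c ∈ M.arrows c c) (S : Subgroup (a ⟶ a))
    (h₁ : ∀ m ∈ M.arrows a a, m ∈ S) (h₂ : ∀ m ∈ M.arrows b b, d ≫ m ≫ inv d ∈ S)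
    (h₃ : ∀ m ∈ M.arrows b a, d ≫ m ∈ S) {f : a ⟶ a} (hf : Adjoin M d f) : f ∈ S := by
  -- A word starting at `a` splits into loops at `a` of the three given kinds and a remainder in
  -- `M`, preceded by at most one `d`.
  have key : ∀ {y : C} {f : a ⟶ y}, Adjoin M d f → ∃ s ∈ S,
      (∃ m ∈ M.arrows a y, f = s ≫ m) ∨ ∃ m ∈ M.arrows b y, f = s ≫ d ≫ m := by
    intro y f hf
    induction hf with
    | refl => exact ⟨1, one_mem S, .inl ⟨𝟙 a, hM a, (Category.comp_id _).symm⟩⟩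
    | comp_mem g h _ hh ih =>
      obtain ⟨s, hs, ⟨m, hm, rfl⟩ | ⟨m, hm, rfl⟩⟩ := ih
      · exact ⟨s, hs, .inl ⟨m ≫ h, M.mul hm hh, by simp⟩⟩
      · exact ⟨s, hs, .inr ⟨m ≫ h, M.mul hm hh, by simp⟩⟩
    | comp_hom g _ ih =>
      obtain ⟨s, hs, ⟨m, hm, rfl⟩ | ⟨m, hm, rfl⟩⟩ := ih
      · exact ⟨s ≫ m, S.mul_mem hs (h₁ m hm), .inr ⟨𝟙 b, hM b, by simp⟩⟩
      · exact ⟨s ≫ d ≫ m, S.mul_mem hs (h₃ m hm), .inr ⟨𝟙 b, hM b, by simp⟩⟩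
    | comp_inv g _ ih =>
      obtain ⟨s, hs, ⟨m, hm, rfl⟩ | ⟨m, hm, rfl⟩⟩ := ih
      · refine ⟨s ≫ m ≫ inv d, S.mul_mem hs ?_, .inl ⟨𝟙 a, hM a, by simp⟩⟩
        have := S.inv_mem (h₃ _ (M.inv hm))
        simpa [Groupoid.vertexGroup.inv_eq_inv] using this
      · exact ⟨s ≫ d ≫ m ≫ inv d, S.mul_mem hs (h₂ m hm), .inl ⟨𝟙 a, hM a, by simp⟩⟩
  obtain ⟨s, hs, ⟨m, hm, rfl⟩ | ⟨m, hm, rfl⟩⟩ := key hf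
  · exact S.mul_mem hs (h₁ m hm)
  · exact S.mul_mem hs (h₃ m hm)

/-- The map `E` on morphisms acts on two non-commuting elements `x`, `y` of some vertex group by
`x ↦ x` and `y ↦ y * x ^ m`. -/
def HasUnipotentPair (E : ∀ {x y : C}, (x ⟶ y) → (x ⟶ y)) : Prop :=
  ∃ (c : C) (x y : c ⟶ c) (m : ℤ), ¬ Commute x y ∧ E x = x ∧ E y = y * x ^ m

variable (E : ∀ {x y : C}, (x ⟶ y) → (x ⟶ y))

theorem map_id_of_map_comp
    (hE : ∀ {x y z : C} (f : x ⟶ y) (g : y ⟶ z), E (f ≫ g) = E f ≫ E g) (x : C) : E (𝟙 x) = 𝟙 x := by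
  have h := hE (𝟙 x) (𝟙 x)
  rw [Category.comp_id] at h
  exact ((cancel_epi (E (𝟙 x))).1 ((Category.comp_id _).trans h)).symm

theorem map_inv_of_map_comp
    (hE : ∀ {x y z : C} (f : x ⟶ y) (g : y ⟶ z), E (f ≫ g) = E f ≫ E g)
    {x y : C} (f : x ⟶ y) : E (inv f) = inv (E f) := by
  apply IsIso.eq_inv_of_hom_inv_id
  rw [← hE, IsIso.hom_inv_id, map_id_of_map_comp E hE]

theorem Adjoin.map
    (hE : ∀ {x y z : C} (f : x ⟶ y) (g : y ⟶ z), E (f ≫ g) = E f ≫ E g)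
    {P : b ⟶ b} (hP : P ∈ M.arrows b b) (hd : E d = d ≫ P)
    (hEM : ∀ {x y : C}, ∀ f ∈ M.arrows x y, E f ∈ M.arrows x y) {x y : C} {f : x ⟶ y}
    (hf : Adjoin M d f) : Adjoin M d (E f) := by
  have hd' : Adjoin M d (E d) := by rw [hd]; exact .comp_mem _ _ .of_hom hP
  induction hf with
  | refl => rw [map_id_of_map_comp E hE]; exact .refl
  | comp_mem g h _ hh ih => rw [hE]; exact .comp_mem _ _ ih (hEM _ hh)
  | comp_hom g _ ih => rw [hE]; exact ih.comp hd'
  | comp_inv g _ ih => rw [hE, map_inv_of_map_comp E hE]; exact ih.comp hd'.symm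

/-- If `E` fixes the loops of `M`, then it fixes the loops of the subgroupoid generated by `M` and
a morphism `d` with `E d = d ≫ P`, unless a unipotent pair exists. -/
theorem Adjoin.map_eq_self
    (hE : ∀ {x y z : C} (f : x ⟶ y) (g : y ⟶ z), E (f ≫ g) = E f ≫ E g)
    [∀ c : C, IsFreeGroup (c ⟶ c)]
    (hno : ¬ HasUnipotentPair E) (hM : ∀ c, 𝟙 c ∈ M.arrows c c)
    {P : b ⟶ b} (hP : P ∈ M.arrows b b) (hd : E d = d ≫ P)
    (hEM : ∀ {x y : C}, ∀ f ∈ M.arrows x y, E f ∈ M.arrows x y)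
    (hfix : ∀ c, ∀ f ∈ M.arrows c c, E f = f)
    (κ : ∀ {x y : C}, (x ⟶ y) → ℤ)
    (hκ : ∀ {x y z : C} (f : x ⟶ y) (g : y ⟶ z), κ (f ≫ g) = κ f + κ g)
    (hκM : ∀ {x y : C}, ∀ f ∈ M.arrows x y, κ f = 0) (hκd : κ d ≠ 0)
    {c : C} {f : c ⟶ c} (hf : Adjoin M d f) : E f = f := by
  -- Exponent `0` is allowed in a unipotent pair, so fixed loops at one vertex commute.
  have hcomm : ∀ {c : C} (x y : c ⟶ c), E x = x → E y = y → x ≫ y = y ≫ x := by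
    intro c x y hx hy
    by_contra h
    exact hno ⟨c, x, y, 0, h, hx, by simpa using hy⟩
  have hid := map_id_of_map_comp E hE
  have hinv := fun {x y : C} (f : x ⟶ y) => map_inv_of_map_comp E hE f
  let S : Subgroup (a ⟶ a) :=
    { carrier := {f | E f = f}
      one_mem' := hid a
      mul_mem' := fun {x y} hx hy => (hE x y).trans (congrArg₂ _ hx hy)
      inv_mem' := fun {x} hx => by
        rw [Groupoid.vertexGroup.inv_eq_inv]
        exact (hinv x).trans (by rw [Set.mem_ofPred.1 hx]) }
  have hS : ∀ {f : a ⟶ a}, Adjoin M d f → E f = f := by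
    intro f hf
    refine Adjoin.mem_subgroup hM S (hfix a) ?_ ?_ hf
    -- Here `E` replaces `m` by `P m P⁻¹`, and the fixed loops `P` and `m` at `b` commute.
    · intro m hm
      change E _ = _
      rw [hE, hE, hinv, hd, hfix b m hm, IsIso.inv_comp, Category.assoc]
      congr 1
      rw [← Category.assoc P m, hcomm P m (hfix b P hP) (hfix b m hm)]
      simp
    · intro m hm
      change E _ = _
      set x : a ⟶ a := d ≫ m with hx
      -- The morphism `m` need not be a loop, so `E m` may differ from `m`. The defect `m⁻¹ P E(m)`
      -- is a loop of `M` at `a`; such loops commute, hence are powers of one `g`. Thus `E x = x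
      -- g^k`, and `g`, `x` commute for lack of a pair.
      obtain ⟨g, hg⟩ := IsFreeGroup.exists_eq_zpowers
        ({ carrier := M.arrows a a
           one_mem' := hM a
           mul_mem' := fun h h' => M.mul h h'
           inv_mem' := fun h => M.inv h } : Subgroup (a ⟶ a))
        fun y hy z hz => hcomm y z (hfix a y hy) (hfix a z hz)
      have hgM : g ∈ M.arrows a a := by
        have : g ∈ Subgroup.zpowers g := Subgroup.mem_zpowers g
        rwa [← hg] at this
      have hc : inv m ≫ P ≫ E m ∈ M.arrows a a :=
        M.mul (by simpa using M.inv hm) (M.mul hP (hEM m hm))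
      have hc' : inv m ≫ P ≫ E m ∈ Subgroup.zpowers g := by rw [← hg]; exact hc
      have hEx : E x = x * (inv m ≫ P ≫ E m) := by
        rw [hx, hE, hd, Groupoid.vertexGroup_mul]
        simp
      generalize inv m ≫ P ≫ E m = e at hc hc' hEx
      obtain ⟨k, rfl⟩ := hc'
      have hgx : Commute g x := by
        by_contra h
        exact hno ⟨a, g, x, k, h, hfix a g hgM, hEx⟩
      by_cases h1 : g ^ k = 1
      · simp only [h1, mul_one] at hEx
        exact hEx
      -- Otherwise a nonzero power of `x` is a power of `g^k`, although `κ` vanishes on `M` while `κ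
      -- x = κ d ≠ 0`.
      · obtain ⟨i, j, hj, hij⟩ := IsFreeGroup.exists_zpow_eq_zpow (hgx.symm.zpow_right k) h1
        let K : (a ⟶ a) →* Multiplicative ℤ := MonoidHom.mk' (fun f => Multiplicative.ofAdd (κ f))
          fun f g => congrArg Multiplicative.ofAdd (hκ f g)
        have h2 := congrArg (fun f => (K f).toAdd) hij
        simp only [map_zpow, toAdd_zpow] at h2
        have h3 : (K g).toAdd = 0 := hκM g hgM
        have h4 : (K x).toAdd = κ d := (hκ d m).trans (by rw [hκM m hm, add_zero])
        rw [h3, h4] at h2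
        simp [hj, hκd] at h2
  obtain h | ⟨g, hg⟩ := hf.mem_or_exists hM
  · exact hfix c f h
  -- At `a`, both `g f g⁻¹` and `E(g) g⁻¹` are fixed, hence commute; this cancels the discrepancy
  -- between `E g` and `g`.
  · have h1 : E (g ≫ f ≫ inv g) = g ≫ f ≫ inv g := hS (hg.comp (hf.comp hg.symm))
    have h2 : E (E g ≫ inv g) = E g ≫ inv g := hS ((hg.map E hE hP hd hEM).comp hg.symm)
    have h3 := hcomm _ _ h1 h2
    rw [hE, hE, hinv] at h1
    have h4 : (E g ≫ E f ≫ inv (E g)) ≫ E g ≫ inv g = (E g ≫ inv g) ≫ g ≫ f ≫ inv g := by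
      rw [h1, h3]
    simp only [Category.assoc, IsIso.inv_hom_id_assoc] at h4
    rwa [cancel_epi, cancel_mono] at h4

end Groupoid

end TrainTrack

namespace TrainTrack

open CategoryTheory Quiver

/-! ### Paths in subgraphs and signed edge crossings -/

section Graph

variable {V : Type u} [Quiver.{v} V]

theorem Dart.homotopyClass_swap {a b : V} (d : Dart a b) :
    (Dart.toEdgePath (Sum.swap d : Dart b a)).homotopyClass =
      Groupoid.inv d.toEdgePath.homotopyClass := rfl

theorem EdgePath.inSubgraph_comp {H : Subgraph V} {a b c : V} {p : EdgePath a b}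
    {q : EdgePath b c} (hp : p.InSubgraph H) (hq : q.InSubgraph H) :
    EdgePath.InSubgraph H (Quiver.Path.comp p q : EdgePath a c) := by
  induction q with
  | nil => exact hp
  | cons q d ih => exact ⟨ih hq.1, hq.2⟩

theorem Dart.edge_swap {a b : V} (d : Dart a b) :
    Dart.edge (Sum.swap d : Dart b a) = d.edge := by
  cases d <;> rfl

theorem EdgePath.inSubgraph_reverse {H : Subgraph V} {a b : V} {p : EdgePath a b}
    (hp : p.InSubgraph H) : EdgePath.InSubgraph H (Quiver.Path.reverse p : EdgePath b a) := by
  induction p with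
  | nil => trivial
  | cons p d ih =>
    refine EdgePath.inSubgraph_comp ?_ (ih hp.1)
    refine ⟨trivial, ?_⟩
    change Dart.edge (Sum.swap d) ∈ _
    rw [Dart.edge_swap]
    exact hp.2

theorem EdgePath.inSubgraph_of_edges_eq_univ {H : Subgraph V} (hH : H.edges = Set.univ) {a b : V}
    (p : EdgePath a b) : p.InSubgraph H := by
  induction p with
  | nil => trivial
  | cons p d ih => exact ⟨ih, by rw [hH]; trivial⟩

/-- The homotopy classes of paths in a subgraph. -/
def Subgraph.subgroupoid (H : Subgraph V) : Subgroupoid (Quiver.FreeGroupoid V) where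
  arrows c d := {f | ∃ p : EdgePath (V := V) c.as d.as, p.InSubgraph H ∧ p.homotopyClass = f}
  inv := by
    rintro c d _ ⟨p, hp, rfl⟩
    exact ⟨Quiver.Path.reverse p, EdgePath.inSubgraph_reverse hp, rfl⟩
  mul := by
    rintro c d e _ ⟨p, hp, rfl⟩ _ ⟨q, hq, rfl⟩
    exact ⟨Quiver.Path.comp p q, EdgePath.inSubgraph_comp hp hq, rfl⟩

theorem Subgraph.id_mem_subgroupoid (H : Subgraph V) (c : Quiver.FreeGroupoid V) :
    𝟙 c ∈ H.subgroupoid.arrows c c := ⟨Quiver.Path.nil, trivial, rfl⟩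

theorem exists_homotopyClass {c d : Quiver.FreeGroupoid V} (f : c ⟶ d) :
    ∃ p : EdgePath (V := V) c.as d.as, p.homotopyClass = f :=
  Quot.exists_rep f

/-- If the subgraph `H` has one edge `d` more than `H'`, then paths in `H` are products of paths
in `H'`, of `d` and of its inverse. -/
theorem EdgePath.InSubgraph.adjoin {H H' : Subgraph V} {a b : V} {d : Dart a b}
    (hd : H.edges \ H'.edges = {d.edge}) {x y : V} {p : EdgePath x y} (hp : p.InSubgraph H) :
    Adjoin H'.subgroupoid d.toEdgePath.homotopyClass p.homotopyClass := by
  induction p with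
  | nil => exact .refl
  | cons p e ih =>
    rename_i y z
    have hpe := ih hp.1
    by_cases he : Dart.edge e ∈ H'.edges
    · exact .comp_mem _ _ hpe ⟨Dart.toEdgePath e, ⟨trivial, he⟩, rfl⟩
    · have h : Dart.edge e = Dart.edge d := by
        have : Dart.edge e ∈ H.edges \ H'.edges := ⟨hp.2, he⟩
        rwa [hd] at this
      have h2 := Adjoin.comp_inv (M := H'.subgroupoid) (d := d.toEdgePath.homotopyClass)
        (x := (FreeGroupoid.of V).obj x)
      simp only [← Groupoid.inv_eq_inv, ← Dart.homotopyClass_swap] at h2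
      obtain e | e := e <;> obtain d | d := d <;> cases h
      · exact .comp_hom _ hpe
      · exact h2 _ hpe
      · exact h2 _ hpe
      · exact .comp_hom _ hpe

open Classical in
/-- The signed number of crossings of the edge `e`, as a functor on the fundamental groupoid. -/
noncomputable def crossingFunctor (e : Edge V) :
    Quiver.FreeGroupoid V ⥤ CategoryTheory.SingleObj (Multiplicative ℤ) :=
  FreeGroupoid.lift
    { obj := fun _ => CategoryTheory.SingleObj.star _
      map := fun {a b} f =>
        if (⟨a, b, f⟩ : Edge V) = e then Multiplicative.ofAdd (1 : ℤ) else (1 : Multiplicative ℤ) }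

/-- The signed number of crossings of the edge `e`. -/
noncomputable def crossing (e : Edge V) {x y : Quiver.FreeGroupoid V} (f : x ⟶ y) : ℤ :=
  Multiplicative.toAdd (α := ℤ) ((crossingFunctor e).map f)

theorem crossing_comp (e : Edge V) {x y z : Quiver.FreeGroupoid V} (f : x ⟶ y) (g : y ⟶ z) :
    crossing e (f ≫ g) = crossing e f + crossing e g := by
  rw [crossing, Functor.map_comp]
  exact add_comm _ _

theorem lift_map_toEdgePath_inl {D : Type w} [Groupoid D] (φ : V ⥤q D) {a b : V} (f : a ⟶ b) :
    (FreeGroupoid.lift φ).map (Dart.toEdgePath (Sum.inl f : Dart a b)).homotopyClass = φ.map f :=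
  Category.id_comp (φ.map f)

theorem lift_map_toEdgePath_inr {D : Type w} [Groupoid D] (φ : V ⥤q D) {a b : V} (f : b ⟶ a) :
    (FreeGroupoid.lift φ).map (Dart.toEdgePath (Sum.inr f : Dart a b)).homotopyClass =
      Groupoid.inv (φ.map f) :=
  Category.id_comp (Groupoid.inv (φ.map f))

theorem crossing_eq_zero {e : Edge V} {a b : V} {d : Dart a b} (h : d.edge ≠ e) :
    crossing e d.toEdgePath.homotopyClass = 0 := by
  obtain d | d := d
  · rw [crossing, crossingFunctor, lift_map_toEdgePath_inl]
    exact congrArg Multiplicative.toAdd (if_neg h)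
  · rw [crossing, crossingFunctor, lift_map_toEdgePath_inr]
    exact neg_eq_zero.2 (congrArg Multiplicative.toAdd (if_neg h))

/-- The value is `1` or `-1`, depending on the orientation of `d`. This supplies the `κ d ≠ 0`
needed in `Adjoin.map_eq_self`. -/
theorem crossing_ne_zero {a b : V} (d : Dart a b) :
    crossing d.edge d.toEdgePath.homotopyClass ≠ 0 := by
  obtain d | d := d
  · rw [crossing, crossingFunctor, lift_map_toEdgePath_inl]
    exact ne_of_eq_of_ne (congrArg Multiplicative.toAdd (if_pos rfl)) one_ne_zero
  · rw [crossing, crossingFunctor, lift_map_toEdgePath_inr]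
    exact neg_ne_zero.2 (ne_of_eq_of_ne (congrArg Multiplicative.toAdd (if_pos rfl)) one_ne_zero)

theorem EdgePath.InSubgraph.crossing_eq_zero {H : Subgraph V} {e : Edge V} (he : e ∉ H.edges)
    {x y : V} {p : EdgePath x y} (hp : p.InSubgraph H) : crossing e p.homotopyClass = 0 := by
  induction p with
  | nil => exact congrArg Multiplicative.toAdd ((crossingFunctor e).map_id _)
  | cons p d ih =>
    refine (crossing_comp e (EdgePath.homotopyClass p) (Dart.toEdgePath d).homotopyClass).trans ?_
    have hne : Dart.edge d ≠ e := fun h => he (h ▸ hp.2)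
    rw [ih hp.1, TrainTrack.crossing_eq_zero hne, add_zero]

end Graph

/-! ### Induction over the filtration -/

section IRTT

variable {V : Type u} [Quiver.{v} V] {Ψ : GraphMap V} {k : ℕ} {Fil : Fin (k + 1) → Subgraph V}

/-- Each vertex first appears in some stratum, as an endpoint of its edge, and both endpoints are
fixed. -/
theorem IsPolynomialIRTT.obj_eq (hΨ : IsPolynomialIRTT Ψ k Fil) (x : V) : Ψ.obj x = x := by
  have key : ∀ r : Fin (k + 1), ∀ x ∈ (Fil r).verts, Ψ.obj x = x := by
    intro r
    induction r using Fin.induction with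
    | zero => intro x hx; rw [hΨ.bot_verts] at hx; exact hx.elim
    | succ r ih =>
      intro x hx
      by_cases hx' : x ∈ (Fil r.castSucc).verts
      · exact ih x hx'
      · obtain ⟨a, b, d, -, hv, ha, hb, -⟩ := hΨ.single_edge r
        obtain rfl | rfl := hv ⟨hx, hx'⟩
        · exact ha
        · exact hb
  exact key (Fin.last k) x (by rw [hΨ.top_verts]; trivial)

variable (map : ∀ {a b : V}, (a ⟶ b) → EdgePath a b)

/-- The effect on homotopy classes of a graph map fixing all vertices. -/
def fixedMap {x y : Quiver.FreeGroupoid V} (f : x ⟶ y) : x ⟶ y :=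
  (GraphMap.functor ⟨id, map⟩).map f

theorem fixedMap_comp {x y z : Quiver.FreeGroupoid V} (f : x ⟶ y) (g : y ⟶ z) :
    fixedMap map (f ≫ g) = fixedMap map f ≫ fixedMap map g :=
  (GraphMap.functor ⟨id, map⟩).map_comp f g

theorem fixedMap_dart {a b : V} (d : Dart a b) :
    fixedMap map d.toEdgePath.homotopyClass =
      EdgePath.homotopyClass ((⟨id, map⟩ : GraphMap V).mapDart d) := by
  obtain d | d := d
  · exact lift_map_toEdgePath_inl _ d
  · exact lift_map_toEdgePath_inr _ d

theorem EdgePath.InSubgraph.fixedMap_mem {H : Subgraph V} (hH : (⟨id, map⟩ : GraphMap V).Preserves H)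
    {x y : V} {p : EdgePath x y} (hp : p.InSubgraph H) :
    fixedMap map p.homotopyClass ∈ H.subgroupoid.arrows
      ((FreeGroupoid.of V).obj x) ((FreeGroupoid.of V).obj y) := by
  induction p with
  | nil => exact ⟨Quiver.Path.nil, trivial, (map_id_of_map_comp _ (fixedMap_comp map) _).symm⟩
  | cons p d ih =>
    have h := fixedMap_comp map (EdgePath.homotopyClass p) (Dart.toEdgePath d).homotopyClass
    refine Set.mem_of_eq_of_mem h (H.subgroupoid.mul (ih hp.1) ?_)
    rw [fixedMap_dart]
    refine ⟨_, ?_, rfl⟩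
    obtain d | d := d
    · exact hH.2 _ hp.2
    · exact EdgePath.inSubgraph_reverse (hH.2 _ hp.2)

/-- A polynomial growth improved relative train track map has a unipotent pair, unless it fixes
every element of the fundamental group. -/
theorem IsPolynomialIRTT.fixedMap_eq_self (hΨ : IsPolynomialIRTT ⟨id, map⟩ k Fil)
    [∀ c : Quiver.FreeGroupoid V, IsFreeGroup (c ⟶ c)]
    (hno : ¬ HasUnipotentPair (C := Quiver.FreeGroupoid V) (fixedMap map))
    {c : Quiver.FreeGroupoid V} (f : c ⟶ c) : fixedMap map f = f := by
  have key : ∀ r : Fin (k + 1), ∀ c, ∀ f ∈ (Fil r).subgroupoid.arrows c c,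
      fixedMap map f = f := by
    intro r
    induction r using Fin.induction with
    | zero =>
      rintro ⟨c⟩ _ ⟨p, hp, rfl⟩
      change EdgePath (V := V) c c at p
      cases p with
      | nil => exact map_id_of_map_comp _ (fixedMap_comp map) _
      | cons p d =>
        have := hp.2
        rw [hΨ.bot_edges] at this
        exact this.elim
    | succ r ih =>
      rintro c _ ⟨p, hp, rfl⟩
      obtain ⟨a, b, d, hd, -, ha, hb, P, hP, hdP⟩ := hΨ.single_edge r
      have hd' : d.edge ∈ (Fil r.succ).edges \ (Fil r.castSucc).edges := by rw [hd]; rfl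
      refine Adjoin.map_eq_self (fixedMap map) (fixedMap_comp map) hno
        (Fil r.castSucc).id_mem_subgroupoid (P := P.homotopyClass) ⟨P, hP, rfl⟩ ?_
        (by rintro x y _ ⟨q, hq, rfl⟩; exact hq.fixedMap_mem map (hΨ.invariant _)) ih (crossing d.edge)
        (crossing_comp _) (by rintro x y _ ⟨q, hq, rfl⟩; exact hq.crossing_eq_zero hd'.2)
        (crossing_ne_zero d) (hp.adjoin hd)
      rw [fixedMap_dart, hdP]
      rfl
  obtain ⟨p, hp⟩ := exists_homotopyClass f
  exact key (Fin.last k) c f ⟨p, EdgePath.inSubgraph_of_edges_eq_univ hΨ.top_edges p, hp⟩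

end IRTT

end TrainTrack

/-! ### Transport of the pair to the base point -/

namespace TrainTrack

open CategoryTheory Quiver

/-- If `φ` is induced by a polynomial growth improved relative train track map, then, up to an inner
automorphism, `φ` acts on two non-commuting elements `x`, `y` by `x ↦ x` and `y ↦ y * x ^ m`. -/
theorem exists_conj_unipotentPair {V : Type u} [Quiver.{v} V] (hV : IsConnectedGraph V)
    (Ψ : GraphMap V) (k : ℕ) (Fil : Fin (k + 1) → Subgraph V) (hΨ : IsPolynomialIRTT Ψ k Fil)
    {F : Type w} [Group F] [IsFreeGroup F] (hF : ¬ IsCyclic F) (p : V) (ι : F ≃* FundGroup V p)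
    (φ : F →* F) (hind : IsInducedBy φ Ψ p ι) :
    ∃ (c x y : F) (m : ℤ), ¬ Commute x y ∧ c * φ x * c⁻¹ = x ∧ c * φ y * c⁻¹ = y * x ^ m := by
  have hobj : Ψ.obj = id := funext hΨ.obj_eq
  obtain ⟨obj, map⟩ := Ψ
  subst hobj
  obtain ⟨γ, hγ⟩ := hind
  have hpath : ∀ c : Quiver.FreeGroupoid V, Nonempty ((FreeGroupoid.of V).obj p ⟶ c) := fun c =>
    (hV p c.as).map EdgePath.homotopyClass
  have hfree : ∀ c : Quiver.FreeGroupoid V, IsFreeGroup (c ⟶ c) := fun c =>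
    IsFreeGroup.ofMulEquiv (ι.trans (Groupoid.vertexGroupIsomOfMap (hpath c).some))
  have hpair : HasUnipotentPair (C := Quiver.FreeGroupoid V) (fixedMap map) := by
    by_contra hno
    apply hF
    refine IsFreeGroup.isCyclic_of_commute fun x y => ?_
    by_contra hxy
    refine hno ⟨_, ι x, ι y, 0, fun h => hxy ?_, hΨ.fixedMap_eq_self map hno _, ?_⟩
    · simpa using h.map ι.symm
    · rw [zpow_zero, mul_one]
      exact hΨ.fixedMap_eq_self map hno _
  obtain ⟨c, x, y, m, hxy, hx, hy⟩ := hpair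
  obtain ⟨W⟩ := hpath c
  let e := (Groupoid.vertexGroupIsomOfMap W).symm.trans ι.symm
  let g : FundGroup V p := γ.homotopyClass
  have hφ : ∀ z : F, ι (φ z) = g ≫ fixedMap map (ι z) ≫ inv g := by
    intro z
    rw [← Groupoid.inv_eq_inv]
    exact hγ z
  -- In the conjugator, `g⁻¹` undoes the path `γ`, and `W E(W)⁻¹` replaces the transporting path
  -- `E(W)` by `W`.
  have hconj : ∀ z : c ⟶ c,
      ι.symm (W ≫ inv (fixedMap map W) ≫ inv g) * φ (e z) *
        (ι.symm (W ≫ inv (fixedMap map W) ≫ inv g))⁻¹ = e (fixedMap map z) := by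
    intro z
    apply ι.injective
    have he : ∀ z, ι (e z) = W ≫ z ≫ inv W := fun z => by
      rw [← Groupoid.inv_eq_inv]
      exact ι.apply_symm_apply _
    rw [map_mul, map_mul, map_inv, ι.apply_symm_apply, hφ, he, he, fixedMap_comp, fixedMap_comp,
      map_inv_of_map_comp _ (fixedMap_comp map), Groupoid.vertexGroup.inv_eq_inv]
    simp [Groupoid.vertexGroup_mul]
  refine ⟨_, e x, e y, m, fun h => hxy ?_, (hconj x).trans (congrArg e hx), (hconj y).trans ?_⟩
  · simpa using h.map e.symm
  · exact (congrArg e hy).trans (by rw [map_mul, map_zpow])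

end TrainTrack

/-! ### Ascending HNN extensions and semidirect products -/

theorem mainTheorem3 {V : Type u} [Quiver.{v} V] (hV : TrainTrack.IsConnectedGraph V)
    (Ψ : TrainTrack.GraphMap V) (k : ℕ) (Fil : Fin (k + 1) → TrainTrack.Subgraph V)
    (hΨ : TrainTrack.IsPolynomialIRTT Ψ k Fil)
    {F : Type w} [Group F] [IsFreeGroup F] [Group.FG F] (hF : ¬ IsCyclic F)
    (p : V) (ι : F ≃* TrainTrack.FundGroup V p)
    (φ : F →* F) (hφ : Function.Injective φ) (hind : TrainTrack.IsInducedBy φ Ψ p ι) :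
    ¬ HasFGIP (AscendingHNN φ hφ) ∧
      ∀ θ : MulAut F, (∀ x, θ x = φ x) →
        ¬ HasFGIP (F ⋊[zpowersHom (MulAut F) θ] Multiplicative ℤ) := by
  obtain ⟨c, x, y, m, hxy, hx, hy⟩ :=
    TrainTrack.exists_conj_unipotentPair hV Ψ k Fil hΨ hF p ι φ hind
  constructor
  -- The element `s = c t` acts on `F` as `φ` followed by conjugation by `c`.
  · have ht : ∀ z : F, (HNNExtension.of c * HNNExtension.t : AscendingHNN φ hφ) *
        HNNExtension.of z * (HNNExtension.of c * HNNExtension.t)⁻¹ =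
        HNNExtension.of (c * φ z * c⁻¹) := by
      intro z
      have h : (HNNExtension.t : AscendingHNN φ hφ) * HNNExtension.of z =
          HNNExtension.of (φ z) * HNNExtension.t :=
        HNNExtension.t_mul_of (⟨z, trivial⟩ : (⊤ : Subgroup F))
      rw [mul_assoc (HNNExtension.of c), h]
      simp only [map_mul, map_inv]
      group
    refine not_hasFGIP_of_conj (G := AscendingHNN φ hφ) HNNExtension.of
      (HNNExtension.of_injective _)
      (HNNExtension.lift 1 (Multiplicative.ofAdd 1) (by simp)) (by simp)
      (HNNExtension.of c * HNNExtension.t) (by simp) hxy m ?_ ?_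
    · rw [ht, hx]
    · rw [ht, hy]
  · intro θ hθ
    have ht : ∀ z : F, (SemidirectProduct.inl c * SemidirectProduct.inr (Multiplicative.ofAdd 1) :
        F ⋊[zpowersHom (MulAut F) θ] Multiplicative ℤ) * SemidirectProduct.inl z *
        (SemidirectProduct.inl c * SemidirectProduct.inr (Multiplicative.ofAdd 1))⁻¹ =
        SemidirectProduct.inl (c * φ z * c⁻¹) := by
      intro z
      have h := SemidirectProduct.inl_aut (φ := zpowersHom (MulAut F) θ)
        (Multiplicative.ofAdd 1) z
      have h1 : zpowersHom (MulAut F) θ (Multiplicative.ofAdd 1) = θ := by simp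
      rw [h1, hθ, map_inv] at h
      rw [map_mul, map_mul, h, map_inv]
      group
    refine not_hasFGIP_of_conj SemidirectProduct.inl SemidirectProduct.inl_injective
      SemidirectProduct.rightHom (by simp)
      (SemidirectProduct.inl c * SemidirectProduct.inr (Multiplicative.ofAdd 1))
      (by simp) hxy m ?_ ?_
    · rw [ht, hx]
    · rw [ht, hy]
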